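/- Let $J_\nu(z)=\left(\frac z2\right)^{\nu}\sum_{m\ge 0}\frac{(-1)^m (z/2)^{2m}}{m!\,\Gamma(\nu+m+1)}$ be the Bessel function of the first kind, of integer order $\nu\ge 0$. For $u>0$ put $$\mathcal N(u)=\frac1u\sum_{n=1}^{\infty} n\,J_n(2\sqrt u)^2,\qquad h_n(u)=\sqrt{\frac{n+1}{\mathcal N(u)}}\;u^{-\frac{n+1}{2}}\,J_{n+1}(2\sqrt u)\quad(n=0,1,2,\dots),$$ with the values at $u=0$ given by the limits $\mathcal N(0)=1$ and $h_n(0)=\sqrt{n+1}/(n+1)!$. Let $H$ be a complex Hilbert space (the Fock space) with orthonormal basis $(|n\rangle)_{n\ge 0}$ (the number states), and for $\alpha\in\mathbb C$ define the modified Susskind–Glogower coherent state $$|\alpha\rangle=\sum_{n=0}^{\infty}\alpha^n\,h_n(|\alpha|^2)\,|n\rangle .$$ Then the following hold. (i) For every $u\ge 0$ the series $\sum_n n J_n(2\sqrt u)^2$ converges and $\mathcal N(u)>0$. (ii) For every $\alpha\in\mathbb C$ the series defining $|\alpha\rangle$ converges in $H$, and $\langle\alpha|\alpha\rangle=1$.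 (iii) For every integer $n\ge 1$, the function $t\mapsto J_n(2t)^2/t$ is integrable on $(0,\infty)$ and $\int_0^\infty J_n(2t)^2\,\frac{dt}{t}=\frac1{2n}$. (iv) With weight $w=\mathcal N$ the states resolve the identity on $H$: $$\int_{\mathbb C}\frac{d^2\alpha}{\pi}\,\mathcal N(|\alpha|^2)\,|\alpha\rangle\langle\alpha|=\mathbb 1$$ in the weak sense, i.e. for all $\varphi,\psi\in H$ the function $\alpha\mapsto \frac1\pi\mathcal N(|\alpha|^2)\langle\varphi|\alpha\rangle\langle\alpha|\psi\rangle$ is Lebesgue integrable on $\mathbb C$ and its integral equals $\langle\varphi|\psi\rangle$. -/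

import Mathlib

open MeasureTheory Set

noncomputable section

/-- The Bessel function of the first kind `J_ν` of integer order `ν ≥ 0` on the real line,
`J_ν(z) = (z/2)^ν ∑_{m ≥ 0} (-1)^m (z/2)^{2m} / (m! Γ(ν+m+1))`. -/
def besselJ (ν : ℕ) (z : ℝ) : ℝ :=
  (z / 2) ^ ν *
    ∑' m : ℕ, (-1 : ℝ) ^ m * (z / 2) ^ (2 * m) /
      ((m.factorial : ℝ) * Real.Gamma ((ν : ℝ) + (m : ℝ) + 1))

/-- `𝒩(u) = u⁻¹ ∑_{n ≥ 1} n J_n(2√u)²` for `u > 0`; the value at `u = 0` is the limit there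
(the `n = 0` term of the series below is zero). -/
def sgmN (u : ℝ) : ℝ :=
  if u = 0 then 1
  else (1 / u) * ∑' n : ℕ, (n : ℝ) * besselJ n (2 * Real.sqrt u) ^ 2

/-- `h_n(u) = √((n+1)/𝒩(u)) u^{-(n+1)/2} J_{n+1}(2√u)` for `u > 0`; the value at `u = 0` is the
limit there, as `u^{-(n+1)/2} J_{n+1}(2√u) → 1/(n+1)!`. -/
def sgmH (n : ℕ) (u : ℝ) : ℝ :=
  if u = 0 then Real.sqrt ((n : ℝ) + 1) / ((n + 1).factorial : ℝ)
  else Real.sqrt (((n : ℝ) + 1) / sgmN u) * (1 / u ^ (((n : ℝ) + 1) / 2)) *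
    besselJ (n + 1) (2 * Real.sqrt u)

/-- The modified Susskind–Glogower coherent state `|α⟩ = ∑_n αⁿ h_n(|α|²) |n⟩` in a Fock space
`H` whose number states `|n⟩` are the vectors `b n` of a Hilbert basis. -/
def sgmState {H : Type*} [NormedAddCommGroup H] [InnerProductSpace ℂ H]
    (b : HilbertBasis ℕ ℂ H) (α : ℂ) : H :=
  ∑' n : ℕ, (α ^ n * ((sgmH n (‖α‖ ^ 2) : ℝ) : ℂ)) • b n

/-- `∫ T dμ = A` for a family `T` of bounded operators, in the weak sense: all matrix elements
`⟨φ| T(x) |ψ⟩` are integrable, with integral `⟨φ| A |ψ⟩`. -/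
def HasWeakOperatorIntegral {X H : Type*} [MeasurableSpace X] [NormedAddCommGroup H]
    [InnerProductSpace ℂ H] (μ : Measure X) (T : X → (H →L[ℂ] H)) (A : H →L[ℂ] H) : Prop :=
  ∀ φ ψ : H, Integrable (fun x => inner ℂ φ (T x ψ)) μ ∧
    ∫ x, inner ℂ φ (T x ψ) ∂μ = inner ℂ φ (A ψ)

end

/-! Put `s(α) = √(𝒩/π) |α⟩`. In its coordinates `𝒩` cancels: the `n`-th is `√((n+1)/π) αⁿ r^{-(n+1)}
J_{n+1}(2r)` with `r = |α|`. If these functions are orthonormal in `L²(ℂ)`, then `χ ↦ ⟨s(·), χ⟩` is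
an isometry `H → L²(ℂ)`, which is the weak resolution of the identity
(`integrable_and_integral_inner_mul_inner`). Distinct indices are orthogonal by rotation; the norms
reduce in polar coordinates to `∫ J_{n+1}(2t)² dt/t = 1/(2(n+1))`.

That integral has an explicit antiderivative by telescoping (`hasDerivAt_sum_besselJ_sq`), evaluated
using `J_n → 0` at infinity; the decay comes from an energy estimate for `(J_0, J_1)`. Convergence
and positivity of `𝒩` follow from the power series. -/

open Filter Topology

/-! ### Power series, derivatives and recurrences -/

/-- The general term of the Bessel–Clifford series `∑ (-1)^m y^m / (m! (n+m)!)`. -/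
noncomputable def besselCliffordTerm (n m : ℕ) (y : ℝ) : ℝ :=
  (-1 : ℝ) ^ m * y ^ m / ((m.factorial : ℝ) * ((n + m).factorial : ℝ))

/-- The entire function `g_n` with `J_n(2t) = t ^ n * g_n(t²)`. -/
noncomputable def besselClifford (n : ℕ) (y : ℝ) : ℝ := ∑' m : ℕ, besselCliffordTerm n m y

theorem abs_besselCliffordTerm_le (n m : ℕ) (y : ℝ) :
    |besselCliffordTerm n m y| ≤ |y| ^ m / (m.factorial : ℝ) * (1 / (n.factorial : ℝ)) := by
  have h1 : (0 : ℝ) < m.factorial := by positivity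
  have h2 : (0 : ℝ) < n.factorial := by positivity
  have h3 : (n.factorial : ℝ) ≤ (n + m).factorial := by
    exact_mod_cast Nat.factorial_le (Nat.le_add_right n m)
  have h4 : (0 : ℝ) < (n + m).factorial := by positivity
  unfold besselCliffordTerm
  rw [abs_div, abs_mul, abs_pow, abs_pow, abs_neg, abs_one, one_pow, one_mul,
    abs_of_pos (mul_pos h1 h4), div_mul_div_comm, mul_one]
  gcongr

theorem summable_besselCliffordTerm (n : ℕ) (y : ℝ) :
    Summable fun m => besselCliffordTerm n m y := by
  refine Summable.of_norm_bounded ((Real.summable_pow_div_factorial |y|).mul_right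
    (1 / (n.factorial : ℝ))) fun m => ?_
  exact abs_besselCliffordTerm_le n m y

theorem abs_besselClifford_le (n : ℕ) (y : ℝ) :
    |besselClifford n y| ≤ Real.exp |y| * (1 / (n.factorial : ℝ)) := by
  have h : HasSum (fun m : ℕ => |y| ^ m / (m.factorial : ℝ) * (1 / (n.factorial : ℝ)))
      (Real.exp |y| * (1 / (n.factorial : ℝ))) := by
    refine HasSum.mul_right _ ?_
    rw [Real.exp_eq_exp_ℝ]
    exact NormedSpace.expSeries_div_hasSum_exp |y|
  rw [besselClifford, ← Real.norm_eq_abs (∑' m : ℕ, _)]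
  exact tsum_of_norm_bounded h fun m => abs_besselCliffordTerm_le n m y

theorem hasDerivAt_besselCliffordTerm_succ (n m : ℕ) (y : ℝ) :
    HasDerivAt (besselCliffordTerm n (m + 1)) (-besselCliffordTerm (n + 1) m y) y := by
  have h := ((hasDerivAt_pow (m + 1) y).const_mul ((-1 : ℝ) ^ (m + 1))).div_const
    (((m + 1).factorial : ℝ) * ((n + (m + 1)).factorial : ℝ))
  refine h.congr_deriv ?_
  unfold besselCliffordTerm
  rw [show n + (m + 1) = n + 1 + m by ring, Nat.factorial_succ m]
  have h1 : (m.factorial : ℝ) ≠ 0 := by positivity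
  have h2 : ((n + 1 + m).factorial : ℝ) ≠ 0 := by positivity
  push_cast
  field_simp
  ring

theorem hasDerivAt_besselClifford (n : ℕ) (y : ℝ) :
    HasDerivAt (besselClifford n) (-besselClifford (n + 1) y) y := by
  -- The `m = 0` term is constant, so only the shifted series needs termwise differentiation.
  have key : HasDerivAt (fun z => ∑' m : ℕ, besselCliffordTerm n (m + 1) z)
      (∑' m : ℕ, -besselCliffordTerm (n + 1) m y) y := by
    refine hasDerivAt_tsum_of_isPreconnected
      (u := fun m : ℕ => (|y| + 1) ^ m / (m.factorial : ℝ) * (1 / ((n + 1).factorial : ℝ)))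
      (t := Metric.ball 0 (|y| + 1)) (y₀ := y)
      ((Real.summable_pow_div_factorial _).mul_right _) Metric.isOpen_ball
      (convex_ball _ _).isPreconnected
      (fun m z _ => hasDerivAt_besselCliffordTerm_succ n m z) (fun m z hz => ?_) ?_ ?_ ?_
    · have hz' : |z| ≤ |y| + 1 := by simpa using (Metric.mem_ball.1 hz).le
      rw [norm_neg, Real.norm_eq_abs]
      refine (abs_besselCliffordTerm_le (n + 1) m z).trans ?_
      gcongr
    · simp
    · exact (summable_nat_add_iff 1).2 (summable_besselCliffordTerm n y)
    · simp
  rw [tsum_neg] at key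
  refine (key.const_add (1 / (n.factorial : ℝ))).congr_of_eventuallyEq
    (Filter.Eventually.of_forall fun z => ?_)
  unfold besselClifford
  rw [(summable_besselCliffordTerm n z).tsum_eq_zero_add]
  simp [besselCliffordTerm]

theorem besselClifford_recurrence (n : ℕ) (y : ℝ) :
    besselClifford n y = (n + 1) * besselClifford (n + 1) y - y * besselClifford (n + 2) y := by
  unfold besselClifford
  rw [← tsum_mul_left, ← tsum_mul_left, (summable_besselCliffordTerm n y).tsum_eq_zero_add,
    ((summable_besselCliffordTerm (n + 1) y).mul_left _).tsum_eq_zero_add, add_sub_assoc,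
    ← Summable.tsum_sub]
  · congr 1
    · have h1 : (n.factorial : ℝ) ≠ 0 := by positivity
      simp only [besselCliffordTerm, Nat.factorial_succ, Nat.add_zero]
      push_cast
      field_simp
    · refine tsum_congr fun m => ?_
      have h1 : (m.factorial : ℝ) ≠ 0 := by positivity
      have h2 : ((n + 1 + m).factorial : ℝ) ≠ 0 := by positivity
      have h3 : ((n : ℝ) + 1 + m + 1) ≠ 0 := by positivity
      unfold besselCliffordTerm
      rw [show n + (m + 1) = n + 1 + m by ring, show n + 1 + (m + 1) = (n + 1 + m) + 1 by ring,
        show n + 2 + m = (n + 1 + m) + 1 by ring, Nat.factorial_succ m,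
        Nat.factorial_succ (n + 1 + m)]
      push_cast
      field_simp
      ring
  · exact (summable_nat_add_iff 1).2 ((summable_besselCliffordTerm (n + 1) y).mul_left _)
  · exact (summable_besselCliffordTerm (n + 2) y).mul_left _

theorem besselJ_two_mul (n : ℕ) (t : ℝ) :
    besselJ n (2 * t) = t ^ n * besselClifford n (t ^ 2) := by
  unfold besselJ besselClifford besselCliffordTerm
  rw [show 2 * t / 2 = t by ring]
  congr 1
  refine tsum_congr fun m => ?_
  rw [← pow_mul, ← Nat.cast_add, Real.Gamma_nat_eq_factorial]

theorem abs_besselJ_two_mul_le (n : ℕ) (t : ℝ) :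
    |besselJ n (2 * t)| ≤ |t| ^ n / (n.factorial : ℝ) * Real.exp (t ^ 2) := by
  rw [besselJ_two_mul, abs_mul, abs_pow]
  have h := abs_besselClifford_le n (t ^ 2)
  rw [abs_of_nonneg (sq_nonneg t)] at h
  calc |t| ^ n * |besselClifford n (t ^ 2)|
      ≤ |t| ^ n * (Real.exp (t ^ 2) * (1 / (n.factorial : ℝ))) := by gcongr
    _ = _ := by ring

theorem besselJ_recurrence (n : ℕ) (t : ℝ) :
    (n + 1) * besselJ (n + 1) (2 * t)
      = t * (besselJ n (2 * t) + besselJ (n + 2) (2 * t)) := by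
  simp only [besselJ_two_mul]
  rw [besselClifford_recurrence n]
  ring

theorem hasDerivAt_besselJ_zero (t : ℝ) :
    HasDerivAt (fun s => besselJ 0 (2 * s)) (-2 * besselJ 1 (2 * t)) t := by
  simp only [besselJ_two_mul]
  refine ((hasDerivAt_pow 0 t).mul ((hasDerivAt_besselClifford 0 (t ^ 2)).comp t
    (hasDerivAt_pow 2 t))).congr_deriv ?_
  simp
  ring

theorem hasDerivAt_besselJ_succ (n : ℕ) (t : ℝ) :
    HasDerivAt (fun s => besselJ (n + 1) (2 * s))
      (besselJ n (2 * t) - besselJ (n + 2) (2 * t)) t := by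
  simp only [besselJ_two_mul]
  refine ((hasDerivAt_pow (n + 1) t).mul ((hasDerivAt_besselClifford (n + 1) (t ^ 2)).comp t
    (hasDerivAt_pow 2 t))).congr_deriv ?_
  rw [besselClifford_recurrence n]
  simp
  ring

theorem continuous_besselJ_two_mul (n : ℕ) : Continuous fun t => besselJ n (2 * t) := by
  simp only [besselJ_two_mul]
  have : Continuous (besselClifford n) :=
    continuous_iff_continuousAt.2 fun y => (hasDerivAt_besselClifford n y).continuousAt
  fun_prop

theorem besselJ_zero_zero : besselJ 0 (2 * 0) = 1 := by
  rw [besselJ_two_mul, besselClifford, (summable_besselCliffordTerm 0 _).tsum_eq_zero_add]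
  simp [besselCliffordTerm]

theorem besselJ_succ_zero (n : ℕ) : besselJ (n + 1) (2 * 0) = 0 := by
  rw [besselJ_two_mul]
  simp

/-! ### Decay at infinity -/

theorem besselJ_zero_sq_add_one_sq_le :
    ∃ C : ℝ, ∀ t : ℝ, 1 ≤ t → besselJ 0 (2 * t) ^ 2 + besselJ 1 (2 * t) ^ 2 ≤ C / t := by
  set a : ℝ → ℝ := fun t => besselJ 0 (2 * t) with ha
  set c : ℝ → ℝ := fun t => besselJ 1 (2 * t) with hc
  have hda (t : ℝ) : HasDerivAt a (-2 * c t) t := hasDerivAt_besselJ_zero t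
  have hdc (t : ℝ) (ht : 0 < t) : HasDerivAt c (2 * a t - c t / t) t := by
    refine (hasDerivAt_besselJ_succ 0 t).congr_deriv ?_
    have h := besselJ_recurrence 0 t
    simp only [Nat.cast_zero, zero_add, one_mul] at h
    simp only [ha, hc, zero_add]
    field_simp
    linarith
  -- The energy `t(a² + c²)` has derivative `a² - c²`; subtracting `ac/2` cancels this and leaves
  -- only `ac/(2t)`.
  set G : ℝ → ℝ := fun t => t * (a t ^ 2 + c t ^ 2) - a t * c t / 2 with hG
  have hdG (t : ℝ) (ht : 0 < t) : HasDerivAt G (a t * c t / (2 * t)) t := by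
    refine (((hasDerivAt_id t).mul (((hda t).pow 2).add ((hdc t ht).pow 2))).sub
      (((hda t).mul (hdc t ht)).div_const 2)).congr_deriv ?_
    simp
    field_simp
    ring
  have hFG (t : ℝ) (ht : 1 ≤ t) : t * (a t ^ 2 + c t ^ 2) ≤ 2 * G t := by
    simp only [hG]
    nlinarith [sq_nonneg (a t - c t), sq_nonneg (a t + c t),
      mul_nonneg (sub_nonneg.2 ht) (add_nonneg (sq_nonneg (a t)) (sq_nonneg (c t)))]
  -- Since `G' ≤ G/t²` for `t ≥ 1`, the integrating factor `e^{1/t}` makes the product decrease,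
  -- which bounds `G`.
  have hdE (t : ℝ) (ht : 0 < t) : HasDerivAt (fun s => G s * Real.exp s⁻¹)
      ((a t * c t / (2 * t) - G t / t ^ 2) * Real.exp t⁻¹) t := by
    refine ((hdG t ht).mul (hasDerivAt_inv ht.ne').exp).congr_deriv ?_
    ring
  have hanti : AntitoneOn (fun s => G s * Real.exp s⁻¹) (Ici 1) := by
    refine antitoneOn_of_deriv_nonpos (convex_Ici 1)
      (fun t ht => (hdE t (zero_lt_one.trans_le ht)).continuousAt.continuousWithinAt)
      (fun t ht => ?_) (fun t ht => ?_)
    · rw [interior_Ici] at ht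
      exact (hdE t (zero_lt_one.trans ht)).differentiableAt.differentiableWithinAt
    · rw [interior_Ici] at ht
      have ht0 : 0 < t := zero_lt_one.trans ht
      rw [(hdE t ht0).deriv]
      refine mul_nonpos_of_nonpos_of_nonneg ?_ (Real.exp_pos _).le
      have h1 := hFG t (le_of_lt ht)
      have h2 : a t * c t * t ≤ t * (a t ^ 2 + c t ^ 2) := by
        nlinarith [mul_nonneg ht0.le (sq_nonneg (a t - c t)),
          mul_nonneg ht0.le (add_nonneg (sq_nonneg (a t)) (sq_nonneg (c t)))]
      have h3 : a t * c t / (2 * t) - G t / t ^ 2 = (a t * c t * t - 2 * G t) / (2 * t ^ 2) := by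
        field_simp
      rw [h3]
      exact div_nonpos_of_nonpos_of_nonneg (by linarith) (by positivity)
  refine ⟨2 * (G 1 * Real.exp 1), fun t ht => ?_⟩
  have ht0 : 0 < t := zero_lt_one.trans_le ht
  rw [le_div_iff₀ ht0, mul_comm]
  refine (hFG t ht).trans ?_
  have h1 := hanti (mem_Ici.2 le_rfl) ht ht
  simp only [inv_one] at h1
  have hG0 : 0 ≤ G t := by
    have := hFG t ht
    have h0 : 0 ≤ t * (a t ^ 2 + c t ^ 2) := by positivity
    linarith
  have h2 : G t ≤ G t * Real.exp t⁻¹ :=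
    le_mul_of_one_le_right hG0 (Real.one_le_exp (by positivity))
  linarith

theorem tendsto_besselJ_two_mul_atTop (n : ℕ) :
    Tendsto (fun t => besselJ n (2 * t)) atTop (𝓝 0) := by
  obtain ⟨C, hC⟩ := besselJ_zero_sq_add_one_sq_le
  have hlim : Tendsto (fun t : ℝ => C / t) atTop (𝓝 0) := tendsto_const_nhds.div_atTop tendsto_id
  have of_sq {f : ℝ → ℝ} (hf : ∀ t, 1 ≤ t → f t ^ 2 ≤ C / t) : Tendsto f atTop (𝓝 0) := by
    have h : Tendsto (fun t => f t ^ 2) atTop (𝓝 0) :=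
      squeeze_zero' (Eventually.of_forall fun t => sq_nonneg _)
        ((eventually_ge_atTop 1).mono hf) hlim
    have h' := h.sqrt
    simp only [Real.sqrt_sq_eq_abs, Real.sqrt_zero] at h'
    exact (tendsto_zero_iff_abs_tendsto_zero f).2 h'
  induction n using Nat.twoStepInduction with
  | zero => exact of_sq fun t ht => by nlinarith [hC t ht, sq_nonneg (besselJ 1 (2 * t))]
  | one => exact of_sq fun t ht => by nlinarith [hC t ht, sq_nonneg (besselJ 0 (2 * t))]
  | more n ih0 ih1 =>
    have h : Tendsto (fun t : ℝ => ((n : ℝ) + 1) / t * besselJ (n + 1) (2 * t) - besselJ n (2 * t))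
        atTop (𝓝 (0 * 0 - 0)) :=
      ((tendsto_const_nhds.div_atTop tendsto_id).mul ih1).sub ih0
    rw [mul_zero, sub_zero] at h
    refine h.congr' ((eventually_gt_atTop 0).mono fun t ht => ?_)
    rw [div_mul_eq_mul_div, besselJ_recurrence, mul_div_cancel_left₀ _ ht.ne']
    ring

/-! ### The Bessel integral -/

/-- `-2(n+1) J_{n+1}(2t)²/t` has the antiderivative `J_0² + 2 J_1² + ⋯ + 2 J_n² + J_{n+1}²`. -/
theorem hasDerivAt_sum_besselJ_sq (n : ℕ) {t : ℝ} (ht : t ≠ 0) :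
    HasDerivAt (fun s => ∑ k ∈ Finset.range (n + 1),
        (besselJ k (2 * s) ^ 2 + besselJ (k + 1) (2 * s) ^ 2))
      (-(2 * ((n : ℝ) + 1)) * (besselJ (n + 1) (2 * t) ^ 2 / t)) t := by
  -- For `k ≥ 1` the `k`-th summand has derivative `2 J_{k-1} J_k - 2 J_{k+1} J_{k+2}`, so the sum
  -- telescopes.
  have key : HasDerivAt (fun s => ∑ k ∈ Finset.range (n + 1),
        (besselJ k (2 * s) ^ 2 + besselJ (k + 1) (2 * s) ^ 2))
      (-2 * besselJ (n + 1) (2 * t) * (besselJ n (2 * t) + besselJ (n + 2) (2 * t))) t := by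
    induction n with
    | zero =>
      simp only [zero_add, Finset.sum_range_one]
      refine (((hasDerivAt_besselJ_zero t).pow 2).add
        ((hasDerivAt_besselJ_succ 0 t).pow 2)).congr_deriv ?_
      simp
      ring
    | succ n ih =>
      simp only [Finset.sum_range_succ _ (n + 1)]
      refine (ih.add (((hasDerivAt_besselJ_succ n t).pow 2).add
        ((hasDerivAt_besselJ_succ (n + 1) t).pow 2))).congr_deriv ?_
      simp
      ring
  refine key.congr_deriv ?_
  have h := besselJ_recurrence n t
  have h' : besselJ n (2 * t) + besselJ (n + 2) (2 * t)
      = (n + 1) * besselJ (n + 1) (2 * t) / t := by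
    field_simp
    linarith
  rw [h']
  ring

theorem integrableOn_besselJ_sq_div_and_integral (n : ℕ) :
    IntegrableOn (fun t : ℝ => besselJ (n + 1) (2 * t) ^ 2 / t) (Ioi 0) ∧
      ∫ t in Ioi (0 : ℝ), besselJ (n + 1) (2 * t) ^ 2 / t = 1 / (2 * ((n : ℝ) + 1)) := by
  set S : ℝ → ℝ := fun s => ∑ k ∈ Finset.range (n + 1),
    (besselJ k (2 * s) ^ 2 + besselJ (k + 1) (2 * s) ^ 2) with hS
  have hn : (2 * ((n : ℝ) + 1)) ≠ 0 := by positivity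
  have hcont : Continuous S := by
    have := continuous_besselJ_two_mul
    fun_prop
  have hd : ∀ t ∈ Ioi (0 : ℝ), HasDerivAt (fun s => -S s / (2 * ((n : ℝ) + 1)))
      (besselJ (n + 1) (2 * t) ^ 2 / t) t := fun t ht => by
    refine ((hasDerivAt_sum_besselJ_sq n (ne_of_gt ht)).neg.div_const _).congr_deriv ?_
    field_simp
  have hpos : ∀ t ∈ Ioi (0 : ℝ), 0 ≤ besselJ (n + 1) (2 * t) ^ 2 / t := fun t ht =>
    div_nonneg (sq_nonneg _) (le_of_lt ht)
  have hlim : Tendsto (fun s => -S s / (2 * ((n : ℝ) + 1))) atTop (𝓝 0) := by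
    have h : Tendsto S atTop (𝓝 (∑ k ∈ Finset.range (n + 1), ((0 : ℝ) ^ 2 + 0 ^ 2))) :=
      tendsto_finsetSum _ fun k _ => ((tendsto_besselJ_two_mul_atTop k).pow 2).add
        ((tendsto_besselJ_two_mul_atTop (k + 1)).pow 2)
    simpa using h.neg.div_const (2 * ((n : ℝ) + 1))
  have hc0 : ContinuousWithinAt (fun s => -S s / (2 * ((n : ℝ) + 1))) (Ici 0) 0 :=
    (hcont.neg.div_const _).continuousWithinAt
  refine ⟨integrableOn_Ioi_deriv_of_nonneg hc0 hd hpos hlim, ?_⟩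
  rw [integral_Ioi_of_hasDerivAt_of_nonneg hc0 hd hpos hlim]
  have h0 : S 0 = 1 := by
    simp only [hS]
    rw [Finset.sum_range_succ', besselJ_zero_zero, besselJ_succ_zero,
      Finset.sum_eq_zero fun k _ => by rw [besselJ_succ_zero, besselJ_succ_zero]; norm_num]
    norm_num
  rw [h0]
  ring

/-! ### Convergence and positivity of the weight -/

theorem summable_nat_mul_besselJ_sq (t : ℝ) :
    Summable fun n : ℕ => (n : ℝ) * besselJ n (2 * t) ^ 2 := by
  refine Summable.of_nonneg_of_le (fun n => by positivity) (fun n => ?_)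
    ((Real.summable_pow_div_factorial (t ^ 2)).mul_right (Real.exp (t ^ 2) ^ 2))
  have h1 : (0 : ℝ) < n.factorial := by positivity
  have h2 : (n : ℝ) ≤ n.factorial := by exact_mod_cast Nat.self_le_factorial n
  calc (n : ℝ) * besselJ n (2 * t) ^ 2
      = n * |besselJ n (2 * t)| ^ 2 := by rw [sq_abs]
    _ ≤ n.factorial * (|t| ^ n / (n.factorial : ℝ) * Real.exp (t ^ 2)) ^ 2 := by
        gcongr
        exact abs_besselJ_two_mul_le n t
    _ = (|t| ^ 2) ^ n / (n.factorial : ℝ) * Real.exp (t ^ 2) ^ 2 := by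
        field_simp
        ring
    _ = _ := by rw [sq_abs]

theorem besselClifford_zero (n : ℕ) : besselClifford n 0 = 1 / (n.factorial : ℝ) := by
  rw [besselClifford, (summable_besselCliffordTerm n _).tsum_eq_zero_add]
  simp [besselCliffordTerm]

theorem abs_besselClifford_sub_le (n : ℕ) {y : ℝ} (hy : 0 ≤ y) :
    |besselClifford n y - 1 / (n.factorial : ℝ)|
      ≤ Real.exp y * (1 / ((n + 1).factorial : ℝ)) * y := by
  have h := Convex.norm_image_sub_le_of_norm_hasDerivWithin_le (s := Icc 0 y)
    (f := besselClifford n) (f' := fun z => -besselClifford (n + 1) z)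
    (C := Real.exp y * (1 / ((n + 1).factorial : ℝ)))
    (fun z _ => (hasDerivAt_besselClifford n z).hasDerivWithinAt)
    (fun z hz => by
      rw [norm_neg, Real.norm_eq_abs]
      refine (abs_besselClifford_le (n + 1) z).trans ?_
      rw [abs_of_nonneg hz.1]
      gcongr
      exact hz.2)
    (convex_Icc 0 y) (left_mem_Icc.2 hy) (right_mem_Icc.2 hy)
  rwa [besselClifford_zero, sub_zero, Real.norm_eq_abs, Real.norm_eq_abs, abs_of_nonneg hy] at h

/-- For fixed `t` and large order, the leading term of the power series dominates the remainder. -/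
theorem exists_besselJ_succ_pos {t : ℝ} (ht : 0 < t) : ∃ n, 0 < besselJ (n + 1) (2 * t) := by
  obtain ⟨n, hn⟩ := exists_nat_gt (Real.exp (t ^ 2) * t ^ 2)
  refine ⟨n, ?_⟩
  rw [besselJ_two_mul]
  refine mul_pos (by positivity) ?_
  have h := (abs_le.1 (abs_besselClifford_sub_le (n + 1) (sq_nonneg t))).1
  have h1 : (0 : ℝ) < (n + 1).factorial := by positivity
  have h2 : Real.exp (t ^ 2) * (1 / ((n + 1 + 1).factorial : ℝ)) * t ^ 2
      < 1 / ((n + 1).factorial : ℝ) := by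
    rw [Nat.factorial_succ (n + 1)]
    push_cast
    rw [mul_one_div, div_mul_eq_mul_div, div_lt_div_iff₀ (by positivity) h1]
    nlinarith
  linarith

theorem sgmN_sq {t : ℝ} (ht : 0 < t) :
    sgmN (t ^ 2) = 1 / t ^ 2 * ∑' n : ℕ, (n : ℝ) * besselJ n (2 * t) ^ 2 := by
  rw [sgmN, if_neg (by positivity), Real.sqrt_sq ht.le]

theorem sgmN_sq_pos (t : ℝ) : 0 < sgmN (t ^ 2) := by
  wlog ht : 0 < t generalizing t
  · rcases (not_lt.1 ht).eq_or_lt with rfl | h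
    · simp [sgmN]
    · simpa using this (-t) (by linarith)
  rw [sgmN_sq ht]
  obtain ⟨n, hn⟩ := exists_besselJ_succ_pos ht
  refine mul_pos (by positivity)
    ((summable_nat_mul_besselJ_sq t).tsum_pos (fun _ => by positivity) (n + 1) ?_)
  positivity

/-! ### Coefficients and normalisation of the states -/

theorem sgmH_sq (n : ℕ) {t : ℝ} (ht : 0 < t) :
    sgmH n (t ^ 2) = Real.sqrt (((n : ℝ) + 1) / sgmN (t ^ 2)) / t ^ (n + 1)
      * besselJ (n + 1) (2 * t) := by
  rw [sgmH, if_neg (by positivity), Real.sqrt_sq ht.le]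
  have h : (t ^ 2) ^ (((n : ℝ) + 1) / 2) = t ^ (n + 1) := by
    rw [← Real.rpow_natCast_mul ht.le, ← Real.rpow_natCast]
    congr 1
    push_cast
    ring
  rw [h, mul_one_div]

/-- The number-state coefficients of the modified Susskind–Glogower state form a unit vector
of `ℓ²`. -/
theorem hasSum_norm_sq_sgmCoeff (α : ℂ) :
    HasSum (fun n : ℕ => ‖α ^ n * ((sgmH n (‖α‖ ^ 2) : ℝ) : ℂ)‖ ^ 2) 1 := by
  rcases eq_or_ne α 0 with rfl | hα
  · convert! hasSum_ite_eq (0 : ℕ) (1 : ℝ) using 2 with n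
    rcases n with _ | n <;> simp [sgmH]
  have ht : 0 < ‖α‖ := norm_pos_iff.2 hα
  have hN := sgmN_sq_pos ‖α‖
  have hS := (summable_nat_mul_besselJ_sq ‖α‖).hasSum
  rw [← hasSum_nat_add_iff' 1] at hS
  simp only [Finset.sum_range_one, Nat.cast_zero, zero_mul, sub_zero] at hS
  have hS' := hS.mul_left (1 / (‖α‖ ^ 2 * sgmN (‖α‖ ^ 2)))
  have hval : 1 / (‖α‖ ^ 2 * sgmN (‖α‖ ^ 2)) *
      ∑' n : ℕ, (n : ℝ) * besselJ n (2 * ‖α‖) ^ 2 = 1 := by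
    have h := sgmN_sq ht
    field_simp at h ⊢
    linarith
  rw [hval] at hS'
  refine hS'.congr_fun fun n => ?_
  rw [norm_mul, norm_pow, Complex.norm_real, mul_pow, Real.norm_eq_abs, sq_abs, sgmH_sq n ht,
    mul_pow, div_pow, Real.sq_sqrt (by positivity)]
  push_cast
  field_simp
  ring

/-- Convergence is transported from `ℓ²` through `b.repr`, so completeness of `H` need not be
assumed. -/
theorem exists_hasSum_smul_hilbertBasis {H : Type*} [NormedAddCommGroup H]
    [InnerProductSpace ℂ H] (b : HilbertBasis ℕ ℂ H) {c : ℕ → ℂ} {a : ℝ}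
    (hc : HasSum (fun n => ‖c n‖ ^ 2) a) :
    ∃ v : H, HasSum (fun n => c n • b n) v ∧ ‖v‖ ^ 2 = a := by
  have hmem : Memℓp c 2 := memℓp_gen (by simpa using hc.summable)
  set f : lp (fun _ : ℕ => ℂ) 2 := ⟨c, hmem⟩
  refine ⟨b.repr.symm f, b.hasSum_repr_symm f, ?_⟩
  rw [LinearIsometryEquiv.norm_map]
  have h := lp.norm_rpow_eq_tsum (p := 2) (by norm_num) f
  simp only [ENNReal.toReal_ofNat, Real.rpow_two] at h
  rw [h]
  exact hc.tsum_eq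

theorem hasSum_sgmState {H : Type*} [NormedAddCommGroup H]
    [InnerProductSpace ℂ H] (b : HilbertBasis ℕ ℂ H) (α : ℂ) :
    HasSum (fun n : ℕ => (α ^ n * ((sgmH n (‖α‖ ^ 2) : ℝ) : ℂ)) • b n) (sgmState b α) := by
  obtain ⟨v, hv, -⟩ := exists_hasSum_smul_hilbertBasis b (hasSum_norm_sq_sgmCoeff α)
  exact hv.summable.hasSum

theorem norm_sgmState {H : Type*} [NormedAddCommGroup H]
    [InnerProductSpace ℂ H] (b : HilbertBasis ℕ ℂ H) (α : ℂ) : ‖sgmState b α‖ = 1 := by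
  obtain ⟨v, hv, hn⟩ := exists_hasSum_smul_hilbertBasis b (hasSum_norm_sq_sgmCoeff α)
  rw [(hasSum_sgmState b α).unique hv]
  exact (pow_eq_one_iff_of_nonneg (norm_nonneg v) two_ne_zero).1 hn

theorem inner_hilbertBasis_sgmState {H : Type*} [NormedAddCommGroup H]
    [InnerProductSpace ℂ H] (b : HilbertBasis ℕ ℂ H) (α : ℂ) (n : ℕ) :
    inner ℂ (b n) (sgmState b α) = α ^ n * ((sgmH n (‖α‖ ^ 2) : ℝ) : ℂ) := by
  have h := (hasSum_sgmState b α).mapL (innerSL ℂ (b n))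
  simp only [innerSL_apply_apply, inner_smul_right] at h
  refine h.unique ?_
  convert! hasSum_ite_eq n (α ^ n * ((sgmH n (‖α‖ ^ 2) : ℝ) : ℂ)) using 2 with m
  rw [orthonormal_iff_ite.1 b.orthonormal]
  rcases eq_or_ne m n with rfl | h
  · simp
  · simp [h, h.symm]

/-! ### Resolution of the identity from orthonormal coordinates -/

/-- A weakly measurable family `s` of vectors whose coordinate functions `⟨s x, b n⟩` are
orthonormal in `L²(μ)` resolves the identity. -/
theorem integrable_and_integral_inner_mul_inner {X H : Type*} [MeasurableSpace X]
    {μ : Measure X} [NormedAddCommGroup H] [InnerProductSpace ℂ H] (b : HilbertBasis ℕ ℂ H)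
    {s : X → H} (hs : ∀ n, MemLp (fun x => inner ℂ (s x) (b n)) 2 μ)
    (horth : ∀ n m, ∫ x, inner ℂ (b n) (s x) * inner ℂ (s x) (b m) ∂μ = if n = m then 1 else 0)
    (φ ψ : H) :
    Integrable (fun x => inner ℂ φ (s x) * inner ℂ (s x) ψ) μ ∧
      ∫ x, inner ℂ φ (s x) * inner ℂ (s x) ψ ∂μ = inner ℂ φ ψ := by
  set e : ℕ → Lp ℂ 2 μ := fun n => (hs n).toLp _ with he
  have he_orth : Orthonormal ℂ e := by
    rw [orthonormal_iff_ite]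
    intro n m
    rw [← horth n m, L2.inner_def]
    refine integral_congr_ae ?_
    filter_upwards [(hs n).coeFn_toLp, (hs m).coeFn_toLp] with x hn hm
    rw [he, hn, hm, RCLike.inner_apply, inner_conj_symm, mul_comm]
  set V := he_orth.orthogonalFamily.linearIsometry.comp b.repr.toLinearIsometry with hV
  have hVcoe (χ : H) : V χ =ᵐ[μ] fun x => inner ℂ (s x) χ := by
    have hsum : HasSum (fun n => b.repr χ n • e n) (V χ) :=
      he_orth.orthogonalFamily.hasSum_linearIsometry (b.repr χ)
    -- `V χ` is only an `L²` limit; along a subsequence it is an almost everywhere limit, comparable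
    -- with the pointwise expansion of `⟨s x, χ⟩`.
    obtain ⟨ns, hns, hlim⟩ :=
      (tendstoInMeasure_of_tendsto_Lp hsum.tendsto_sum_nat).exists_seq_tendsto_ae
    have hcoe : ∀ᵐ x ∂μ, ∀ N : ℕ, (∑ n ∈ Finset.range N, b.repr χ n • e n : Lp ℂ 2 μ) x
        = inner ℂ (s x) (∑ n ∈ Finset.range N, b.repr χ n • b n) := by
      have h1 : ∀ᵐ x ∂μ, ∀ n, (b.repr χ n • e n : Lp ℂ 2 μ) x = b.repr χ n * e n x :=
        ae_all_iff.2 fun n => Lp.coeFn_smul (b.repr χ n) (e n)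
      have h2 : ∀ᵐ x ∂μ, ∀ n, e n x = inner ℂ (s x) (b n) :=
        ae_all_iff.2 fun n => (hs n).coeFn_toLp
      have h3 : ∀ᵐ x ∂μ, ∀ N : ℕ, (∑ n ∈ Finset.range N, b.repr χ n • e n : Lp ℂ 2 μ) x
          = ∑ n ∈ Finset.range N, (b.repr χ n • e n : Lp ℂ 2 μ) x :=
        ae_all_iff.2 fun N => by
          filter_upwards [Lp.coeFn_finsetSum (Finset.range N) fun n => b.repr χ n • e n] with x hx
          rw [hx, Finset.sum_apply]
      filter_upwards [h1, h2, h3] with x h1 h2 h3 N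
      rw [h3, inner_sum]
      exact Finset.sum_congr rfl fun n _ => by rw [h1, h2, inner_smul_right]
    filter_upwards [hlim, hcoe] with x hx hc
    simp only [hc] at hx
    exact tendsto_nhds_unique hx (tendsto_const_nhds.inner
      ((b.hasSum_repr χ).tendsto_sum_nat.comp hns.tendsto_atTop))
  have hinner : (fun x => inner ℂ (V φ x) (V ψ x)) =ᵐ[μ]
      fun x => inner ℂ φ (s x) * inner ℂ (s x) ψ := by
    filter_upwards [hVcoe φ, hVcoe ψ] with x h1 h2
    rw [h1, h2, RCLike.inner_apply, inner_conj_symm, mul_comm]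
  refine ⟨(L2.integrable_inner (V φ) (V ψ)).congr hinner, ?_⟩
  rw [← integral_congr_ae hinner, ← L2.inner_def, LinearIsometry.inner_map_map]

/-! ### Orthonormality of the coordinates in `L²(ℂ)` -/

theorem integral_eq_zero_of_rotation {F : ℂ → ℂ} (a : Circle) (hF : ∀ z, F (a * z) = -F z) :
    ∫ z, F z = 0 := by
  have h := (rotation a).measurePreserving.integral_comp
    (rotation a).toHomeomorph.measurableEmbedding F
  simp only [rotation_apply, hF, integral_neg] at h
  exact self_eq_neg.1 h.symm

theorem exists_circle_pow_mul_conj_pow_eq_neg_one {n m : ℕ} (h : n ≠ m) :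
    ∃ a : Circle, (starRingEnd ℂ (a : ℂ)) ^ n * (a : ℂ) ^ m = -1 := by
  have hne : (m : ℂ) - n ≠ 0 := sub_ne_zero.2 (by exact_mod_cast h.symm)
  -- The product is `e^{i(m-n)θ}`, so `θ = π/(m-n)`.
  refine ⟨Circle.exp (Real.pi / ((m : ℝ) - n)), ?_⟩
  rw [Circle.coe_exp, ← Complex.exp_conj, ← Complex.exp_nat_mul, ← Complex.exp_nat_mul,
    ← Complex.exp_add, ← Complex.exp_pi_mul_I]
  congr 1
  simp only [map_mul, Complex.conj_ofReal, Complex.conj_I]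
  push_cast
  field_simp
  ring

theorem integral_conj_mul_eq_zero_of_ne {n m : ℕ} (h : n ≠ m) (R S : ℝ → ℝ) :
    ∫ z : ℂ, z ^ n * (R ‖z‖ : ℂ) * starRingEnd ℂ (z ^ m * (S ‖z‖ : ℂ)) = 0 := by
  obtain ⟨a, ha⟩ := exists_circle_pow_mul_conj_pow_eq_neg_one h.symm
  refine integral_eq_zero_of_rotation a fun z => ?_
  have hnorm : ‖(a : ℂ) * z‖ = ‖z‖ := by
    rw [norm_mul, Circle.norm_coe, one_mul]
  rw [hnorm]
  simp only [map_mul, map_pow, mul_pow, Complex.conj_ofReal]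
  linear_combination (z ^ n * (R ‖z‖ : ℂ) * (starRingEnd ℂ z) ^ m * (S ‖z‖ : ℂ)) * ha

/-- The radial part of `√(𝒩/π)` times the `n`-th coefficient of the state `|α⟩`. -/
noncomputable def sgmRadial (n : ℕ) (r : ℝ) : ℝ :=
  Real.sqrt (((n : ℝ) + 1) / Real.pi) / r ^ (n + 1) * besselJ (n + 1) (2 * r)

theorem measurable_sgmRadial (n : ℕ) : Measurable (sgmRadial n) := by
  have := (continuous_besselJ_two_mul (n + 1)).measurable
  unfold sgmRadial
  fun_prop

theorem norm_sq_pow_mul_sgmRadial (n : ℕ) {z : ℂ} (hz : z ≠ 0) :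
    ‖z ^ n * (sgmRadial n ‖z‖ : ℂ)‖ ^ 2
      = ((n : ℝ) + 1) / Real.pi * (besselJ (n + 1) (2 * ‖z‖) ^ 2 / ‖z‖ ^ 2) := by
  have ht : 0 < ‖z‖ := norm_pos_iff.2 hz
  have hpi := Real.pi_pos
  rw [norm_mul, norm_pow, Complex.norm_real, mul_pow, Real.norm_eq_abs, sq_abs, sgmRadial,
    mul_pow, div_pow, Real.sq_sqrt (by positivity)]
  field_simp
  ring

theorem sqrt_mul_sgmH (n : ℕ) {t : ℝ} (ht : 0 < t) :
    Real.sqrt (sgmN (t ^ 2) / Real.pi) * sgmH n (t ^ 2) = sgmRadial n t := by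
  have hN := sgmN_sq_pos t
  have hpi := Real.pi_pos
  rw [sgmH_sq n ht, sgmRadial, ← mul_assoc, ← mul_div_assoc, ← Real.sqrt_mul (by positivity)]
  congr 3
  field_simp

/-- Polar coordinates give `2π · (n+1)/π · ∫ J_{n+1}(2r)² dr/r`; the Jacobian `r` turns `1/r²` into
`1/r`. -/
theorem integrable_and_integral_norm_sq_sgmRadial (n : ℕ) :
    Integrable (fun z : ℂ => ‖z ^ n * (sgmRadial n ‖z‖ : ℂ)‖ ^ 2) ∧
      ∫ z : ℂ, ‖z ^ n * (sgmRadial n ‖z‖ : ℂ)‖ ^ 2 = 1 := by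
  set f : ℝ → ℝ := fun r => ((n : ℝ) + 1) / Real.pi * (besselJ (n + 1) (2 * r) ^ 2 / r ^ 2) with hf
  have hae : (fun z : ℂ => f ‖z‖) =ᵐ[volume] fun z : ℂ => ‖z ^ n * (sgmRadial n ‖z‖ : ℂ)‖ ^ 2 := by
    filter_upwards [compl_mem_ae_iff.2 (measure_singleton (μ := (volume : Measure ℂ)) 0)] with z hz
    exact (norm_sq_pow_mul_sgmRadial n hz).symm
  have hr : EqOn (fun y : ℝ => y ^ (Module.finrank ℝ ℂ - 1) • f y)
      (fun y => ((n : ℝ) + 1) / Real.pi * (besselJ (n + 1) (2 * y) ^ 2 / y)) (Ioi 0) := by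
    intro y hy
    have hy' : y ≠ 0 := ne_of_gt hy
    simp only [hf, Complex.finrank_real_complex, smul_eq_mul]
    norm_num
    field_simp
  obtain ⟨hi, hv⟩ := integrableOn_besselJ_sq_div_and_integral n
  constructor
  · refine Integrable.congr ?_ hae
    rw [integrable_fun_norm_addHaar, integrableOn_congr_fun hr measurableSet_Ioi]
    exact hi.const_mul _
  · rw [← integral_congr_ae hae, integral_fun_norm_addHaar,
      setIntegral_congr_fun measurableSet_Ioi hr, integral_const_mul, hv]
    have hball : (volume : Measure ℂ).real (Metric.ball 0 1) = Real.pi := by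
      simp [Measure.real, Complex.volume_ball]
    rw [hball, Complex.finrank_real_complex]
    have hpi := Real.pi_pos
    simp only [smul_eq_mul, nsmul_eq_mul]
    push_cast
    field_simp

theorem memLp_pow_mul_sgmRadial (n : ℕ) :
    MemLp (fun z : ℂ => z ^ n * (sgmRadial n ‖z‖ : ℂ)) 2 := by
  have hmeas : AEStronglyMeasurable (fun z : ℂ => z ^ n * (sgmRadial n ‖z‖ : ℂ)) volume := by
    have := measurable_sgmRadial n
    exact Measurable.aestronglyMeasurable (by fun_prop)
  exact (memLp_two_iff_integrable_sq_norm hmeas).2 (integrable_and_integral_norm_sq_sgmRadial n).1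

/-! ### Assembly -/

theorem hasWeakOperatorIntegral_sgmState {H : Type*} [NormedAddCommGroup H]
    [InnerProductSpace ℂ H] (b : HilbertBasis ℕ ℂ H) :
    HasWeakOperatorIntegral (volume : Measure ℂ)
      (fun α : ℂ => ((sgmN (‖α‖ ^ 2) / Real.pi : ℝ) : ℂ) •
        InnerProductSpace.rankOne ℂ (sgmState b α) (sgmState b α))
      (ContinuousLinearMap.id ℂ H) := by
  intro φ ψ
  set s : ℂ → H := fun α => ((Real.sqrt (sgmN (‖α‖ ^ 2) / Real.pi) : ℝ) : ℂ) • sgmState b α with hs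
  have hcoord (n : ℕ) : (fun α => inner ℂ (b n) (s α)) =ᵐ[volume]
      fun α : ℂ => α ^ n * (sgmRadial n ‖α‖ : ℂ) := by
    -- The origin, where `sgmRadial` divides by zero, is a null set.
    filter_upwards [compl_mem_ae_iff.2 (measure_singleton (μ := (volume : Measure ℂ)) 0)] with α hα
    rw [hs, inner_smul_right, inner_hilbertBasis_sgmState, ← sqrt_mul_sgmH n (norm_pos_iff.2 hα)]
    push_cast
    ring
  have hmem (n : ℕ) : MemLp (fun α => inner ℂ (s α) (b n)) 2 := by
    have h := ((memLp_pow_mul_sgmRadial n).ae_eq (hcoord n).symm).star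
    refine h.ae_eq (Eventually.of_forall fun α => ?_)
    exact inner_conj_symm _ _
  have horth (n m : ℕ) : ∫ α, inner ℂ (b n) (s α) * inner ℂ (s α) (b m)
      = if n = m then 1 else 0 := by
    have hae : (fun α => inner ℂ (b n) (s α) * inner ℂ (s α) (b m)) =ᵐ[volume] fun α : ℂ =>
        α ^ n * (sgmRadial n ‖α‖ : ℂ) * starRingEnd ℂ (α ^ m * (sgmRadial m ‖α‖ : ℂ)) := by
      filter_upwards [hcoord n, hcoord m] with α hn hm
      rw [hn, ← hm, inner_conj_symm]
    rw [integral_congr_ae hae]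
    split_ifs with h
    · subst h
      simp only [Complex.mul_conj']
      rw [← Complex.ofReal_one, ← (integrable_and_integral_norm_sq_sgmRadial n).2,
        ← integral_complex_ofReal]
      push_cast
      rfl
    · exact integral_conj_mul_eq_zero_of_ne h _ _
  have hT (α : ℂ) : inner ℂ φ ((((sgmN (‖α‖ ^ 2) / Real.pi : ℝ) : ℂ) •
        InnerProductSpace.rankOne ℂ (sgmState b α) (sgmState b α)) ψ)
      = inner ℂ φ (s α) * inner ℂ (s α) ψ := by
    have hN : 0 ≤ sgmN (‖α‖ ^ 2) / Real.pi :=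
      div_nonneg (sgmN_sq_pos ‖α‖).le Real.pi_pos.le
    rw [_root_.smul_apply, InnerProductSpace.rankOne_apply, hs, inner_smul_right,
      inner_smul_right, inner_smul_right, inner_smul_left, Complex.conj_ofReal,
      ← Real.mul_self_sqrt hN]
    push_cast
    rw [Real.mul_self_sqrt hN]
    ring
  simp only [hT]
  exact integrable_and_integral_inner_mul_inner b hmem horth φ ψ

theorem mainTheorem6 {H : Type*} [NormedAddCommGroup H] [InnerProductSpace ℂ H] [CompleteSpace H]
    (b : HilbertBasis ℕ ℂ H) :
    -- the normalising series converges, and the weight is positive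
    (∀ u : ℝ, 0 ≤ u →
      Summable (fun n : ℕ => (n : ℝ) * besselJ n (2 * Real.sqrt u) ^ 2) ∧ 0 < sgmN u) ∧
    -- the states are well-defined unit vectors of the Fock space
    (∀ α : ℂ, Summable (fun n : ℕ => (α ^ n * ((sgmH n (‖α‖ ^ 2) : ℝ) : ℂ)) • b n) ∧
      ‖sgmState b α‖ = 1) ∧
    -- the Bessel integral
    (∀ n : ℕ, 1 ≤ n →
      IntegrableOn (fun t : ℝ => besselJ n (2 * t) ^ 2 / t) (Ioi 0) ∧
      ∫ t in Ioi (0 : ℝ), besselJ n (2 * t) ^ 2 / t = 1 / (2 * (n : ℝ))) ∧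
    -- the resolution of the identity with weight `w = 𝒩`
    HasWeakOperatorIntegral (volume : Measure ℂ)
      (fun α : ℂ => ((sgmN (‖α‖ ^ 2) / Real.pi : ℝ) : ℂ) •
        InnerProductSpace.rankOne ℂ (sgmState b α) (sgmState b α))
      (ContinuousLinearMap.id ℂ H) := by
  refine ⟨fun u hu => ⟨summable_nat_mul_besselJ_sq _, ?_⟩,
    fun α => ⟨(hasSum_sgmState b α).summable, norm_sgmState b α⟩, fun n hn => ?_,
    hasWeakOperatorIntegral_sgmState b⟩
  · rw [← Real.sq_sqrt hu]
    exact sgmN_sq_pos _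
  · obtain ⟨m, rfl⟩ := Nat.exists_eq_add_of_le' hn
    rw [Nat.cast_add_one]
    exact integrableOn_besselJ_sq_div_and_integral m
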